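/- For integers $q,a\ge 1$ let $c_q(a)=\sum_{1\le h\le q,\ \gcd(h,q)=1} e^{2\pi i a h/q}$ be the Ramanujan sum. Let $G:\{1,2,3,\dots\}\to\mathbb{C}$ be a multiplicative function, that is, $G(1)=1$ and $G(mn)=G(m)G(n)$ whenever $\gcd(m,n)=1$. Suppose that $G$ is not exotic, that is, there is no prime $p$ such that $G(p^K)=1$ for all integers $K\ge 0$. Suppose moreover that $G(q)=O(1/q)$ for $q$ squarefree, and that for some real $\alpha>0$ $$G(p)=\frac1p+O\left(p^{-1-\alpha}\right)\qquad\text{as } p\to\infty \text{ along the primes}.$$ Then $G$ is a Ramanujan coefficient, that is, the series $\sum_{q=1}^{\infty}G(q)c_q(a)$ converges (as the limit of its partial sums $\sum_{q\le Q}$ as $Q\to\infty$) for every integer $a\ge 1$; and $G$ belongs to the Ramanujan cloud of the zero function, that is, $$\sum_{q=1}^{\infty}G(q)\,c_q(a)=0\qquad\text{for every integer } a\ge 1.$$ -/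

import Mathlib

open scoped Topology
open Filter Asymptotics

noncomputable section

namespace RamanujanExpansion

/-- The Ramanujan sum `c_q(a)`: the sum of `exp (2πi a h / q)` over a reduced residue system `h`
modulo `q`. The range `1 ≤ h ≤ q` gives `c_1(a) = 1`. -/
def ramanujanSum (q a : ℕ) : ℂ :=
  ∑ h ∈ (Finset.Icc 1 q).filter (fun h => Nat.Coprime h q),
    Complex.exp (2 * Real.pi * Complex.I * a * h / q)

/-- The partial sum over `1 ≤ q ≤ Q` of the Ramanujan series of `G` at `a`. -/
def partialSum (G : ArithmeticFunction ℂ) (a Q : ℕ) : ℂ :=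
  ∑ q ∈ Finset.Icc 1 Q, G q * ramanujanSum q a

/-- `G` is a Ramanujan coefficient: its Ramanujan series converges (conditionally, in the natural
order of `q`) at every integer `a ≥ 1`. -/
def IsRamanujanCoefficient (G : ArithmeticFunction ℂ) : Prop :=
  ∀ a : ℕ, 1 ≤ a → ∃ L : ℂ, Tendsto (partialSum G a) atTop (𝓝 L)

/-- The Ramanujan cloud of `F`: all `G` whose Ramanujan series converges to `F a` at every
integer `a ≥ 1`. -/
def ramanujanCloud (F : ArithmeticFunction ℂ) : Set (ArithmeticFunction ℂ) :=
  {G | ∀ a : ℕ, 1 ≤ a → Tendsto (partialSum G a) atTop (𝓝 (F a))}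

/-- The set of invisible primes of `G`: those `p` with `G (p ^ K) = 1` for all `K ≥ 0`. -/
def invisiblePrimes (G : ArithmeticFunction ℂ) : Set ℕ :=
  {p | p.Prime ∧ ∀ K : ℕ, G (p ^ K) = 1}

/-- `G` is exotic when it has at least one invisible prime. -/
def IsExotic (G : ArithmeticFunction ℂ) : Prop :=
  (invisiblePrimes G).Nonempty

end RamanujanExpansion

end

noncomputable section

/-! ### A Tauberian theorem by Fourier smoothing -/

namespace RamanujanExpansion

open MeasureTheory FourierTransform

/-! Since `c_q(a) = ∑ d μ(q/d)` over `d ∣ gcd(a, q)`, the partial sum at `a` is a finite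
combination, over `d ∣ a`, of sums `∑ μ(m) G(dm)` with `m ≤ Q/d`. Sorting `m = ej` by `e = gcd(m,
d)` factors each term as `μ(e) G(de) · μ(j) G(j)` with `j` coprime to `d`. It remains to show that
`g = μG`, restricted to integers coprime to `d`, has series zero
(`tendsto_sum_zero_of_summable_prime`).

This `g` is multiplicative, vanishes at higher prime powers and is close to `-1/p` at primes, so it
is a perturbation of `μ(n)/n`: `g = h * (μ(n)/n)` with `h` absolutely summable. Dominated
convergence reduces the claim to `∑ μ(n)/n = 0`, which is equivalent to the prime number theorem
(`tendsto_sum_moebiusDiv`). That follows from the nonvanishing of `ζ` on `Re s = 1`: the Laplace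
transform of `∑_{n ≤ e^t} μ(n)/n` is `1/(s ζ(1+s))`, continuous up to `Re s = 0`, and
`tendsto_zero_of_laplace_continuousOn` applies. -/

lemma fourier_eq_integral_exp (f : ℝ → ℂ) (w : ℝ) :
    𝓕 f w = ∫ v : ℝ, Complex.exp (-(2 * Real.pi * w * v * Complex.I)) * f v := by
  rw [Real.fourier_eq']
  congr 1 with v
  rw [smul_eq_mul]
  congr 2
  simp
  ring

/-- The multiplication formula for the Fourier transform, with one factor translated. -/
lemma integral_fourier_translate_mul {φ g : ℝ → ℂ} (hφ : Integrable φ) (hg : Integrable g)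
    (T : ℝ) :
    ∫ v, 𝓕 φ (v - T) * g v =
      ∫ u : ℝ, Complex.exp (2 * Real.pi * T * u * Complex.I) * φ u * 𝓕 g u := by
  have hint : Integrable fun u : ℝ => Complex.exp (2 * Real.pi * T * u * Complex.I) * φ u := by
    refine hφ.bdd_mul (c := 1) (by fun_prop) (ae_of_all _ fun u => ?_)
    rw [show (2 * Real.pi * T * u * Complex.I : ℂ) = ((2 * Real.pi * T * u : ℝ) : ℂ) * Complex.I by
      push_cast; ring, Complex.norm_exp_ofReal_mul_I]
  have hmod (v : ℝ) : 𝓕 φ (v - T) =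
      𝓕 (fun u : ℝ => Complex.exp (2 * Real.pi * T * u * Complex.I) * φ u) v := by
    rw [fourier_eq_integral_exp, fourier_eq_integral_exp]
    congr 1 with u
    rw [← mul_assoc, ← Complex.exp_add]
    congr 2
    push_cast
    ring
  simp_rw [hmod]
  have := VectorFourier.integral_fourierIntegral_smul_eq_flip (L := innerₗ ℝ)
    Real.continuous_fourierChar continuous_inner hint hg
  rw [flip_innerₗ] at this
  exact this

/-- If the Laplace transform of a bounded function `F` extends continuously to the closed right
half plane, then smoothing `F` by a kernel with compactly supported Fourier transform makes it tend
to zero. -/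
lemma tendsto_integral_fourier_translate_mul {F : ℝ → ℂ} (hFm : Measurable F) {C : ℝ}
    (hFC : ∀ t, ‖F t‖ ≤ C) (hF0 : ∀ t < 0, F t = 0) {H : ℂ → ℂ}
    (hHc : ContinuousOn H {s | 0 ≤ s.re})
    (hH : ∀ s : ℂ, 0 < s.re → ∫ t : ℝ, Complex.exp (-s * t) * F t = H s)
    {φ : ℝ → ℂ} (hφ : Continuous φ) (hφc : HasCompactSupport φ) (hφi : Integrable (𝓕 φ)) :
    Tendsto (fun T : ℝ => ∫ v, 𝓕 φ (v - T) * F v) atTop (𝓝 0) := by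
  have hφint : Integrable φ := hφ.integrable_of_hasCompactSupport hφc
  have hline (ε : ℝ) (hε : 0 ≤ ε) : Continuous fun u : ℝ => H (ε + 2 * Real.pi * u * Complex.I) :=
    hHc.comp_continuous (by fun_prop) fun u => by simpa using hε
  have hnorm (T u : ℝ) : ‖Complex.exp (2 * Real.pi * T * u * Complex.I)‖ = 1 := by
    rw [show (2 * Real.pi * T * u * Complex.I : ℂ) = ((2 * Real.pi * T * u : ℝ) : ℂ) * Complex.I by
      push_cast; ring, Complex.norm_exp_ofReal_mul_I]
  have hdamp (ε : ℝ) (hε : 0 < ε) : Integrable fun t : ℝ => Complex.exp (-ε * t) * F t := by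
    have hbd : IntegrableOn (fun t : ℝ => Real.exp (-ε * t)) (Set.Ici 0) := by
      rw [integrableOn_Ici_iff_integrableOn_Ioi]
      exact exp_neg_integrableOn_Ioi 0 hε
    have hon : IntegrableOn (fun t : ℝ => Complex.exp (-ε * t) * F t) (Set.Ici 0) := by
      refine (hbd.const_mul C).mono' (by fun_prop) (ae_of_all _ fun t => ?_)
      rw [norm_mul, Complex.norm_exp, mul_comm C]
      simp only [neg_mul, Complex.neg_re, Complex.mul_re, Complex.ofReal_re, Complex.ofReal_im,
        mul_zero, sub_zero]
      gcongr
      exact hFC t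
    refine (integrableOn_iff_integrable_of_support_subset fun t ht => ?_).mp hon
    by_contra h
    exact ht (by simp [hF0 t (not_le.mp h)])
  have hdampF (ε : ℝ) (hε : 0 < ε) (u : ℝ) :
      𝓕 (fun t : ℝ => Complex.exp (-ε * t) * F t) u = H (ε + 2 * Real.pi * u * Complex.I) := by
    rw [fourier_eq_integral_exp, ← hH _ (by simpa using hε)]
    congr 1 with t
    rw [← mul_assoc, ← Complex.exp_add]
    congr 2
    ring
  -- Damp `F` by `e^{-εt}`, apply the multiplication formula and let `ε → 0`. The left side is
  -- dominated by `C‖𝓕 φ‖`; on the right, `H` is bounded on the compact set swept out by `[0, 1] ×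
  -- tsupport φ`.
  have key (T : ℝ) : ∫ v, 𝓕 φ (v - T) * F v =
      ∫ u : ℝ, Complex.exp (2 * Real.pi * T * u * Complex.I) * φ u *
        H (((0 : ℝ) : ℂ) + 2 * Real.pi * u * Complex.I) := by
    have hL : Tendsto (fun ε : ℝ => ∫ v : ℝ, 𝓕 φ (v - T) * (Complex.exp (-ε * v) * F v))
        (𝓝[>] 0) (𝓝 (∫ v, 𝓕 φ (v - T) * F v)) := by
      refine tendsto_integral_filter_of_dominated_convergence
        (fun v => ‖𝓕 φ (v - T)‖ * C) ?_ ?_ ((hφi.comp_sub_right T).norm.mul_const C) ?_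
      · refine Eventually.of_forall fun ε => ?_
        exact (hφi.comp_sub_right T).aestronglyMeasurable.mul (by fun_prop)
      · filter_upwards [self_mem_nhdsWithin] with ε hε
        refine ae_of_all _ fun v => ?_
        rw [norm_mul]
        gcongr
        rcases lt_or_ge v 0 with hv | hv
        · rw [hF0 v hv, mul_zero, norm_zero]
          exact (norm_nonneg _).trans (hFC 0)
        · rw [norm_mul, Complex.norm_exp]
          refine (mul_le_of_le_one_left (norm_nonneg _) ?_).trans (hFC v)
          simpa using mul_nonneg (le_of_lt hε) hv
      · refine ae_of_all _ fun v => ?_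
        have : Continuous fun ε : ℝ => 𝓕 φ (v - T) * (Complex.exp (-ε * v) * F v) := by fun_prop
        simpa using (this.tendsto 0).mono_left nhdsWithin_le_nhds
    have hR : Tendsto (fun ε : ℝ => ∫ u : ℝ, Complex.exp (2 * Real.pi * T * u * Complex.I) * φ u *
        H (ε + 2 * Real.pi * u * Complex.I)) (𝓝[>] 0)
        (𝓝 (∫ u : ℝ, Complex.exp (2 * Real.pi * T * u * Complex.I) * φ u *
          H (((0 : ℝ) : ℂ) + 2 * Real.pi * u * Complex.I))) := by
      obtain ⟨B, hB⟩ : ∃ B, ∀ p ∈ Set.Icc (0 : ℝ) 1 ×ˢ tsupport φ,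
          ‖H (p.1 + 2 * Real.pi * p.2 * Complex.I)‖ ≤ B := by
        refine (isCompact_Icc.prod hφc).exists_bound_of_continuousOn ?_
        refine hHc.comp (by fun_prop) fun p hp => ?_
        simpa using hp.1.1
      refine tendsto_integral_filter_of_dominated_convergence
        (fun u => ‖φ u‖ * B) ?_ ?_ (hφint.norm.mul_const B) ?_
      · filter_upwards [self_mem_nhdsWithin] with ε hε
        have := hline ε (le_of_lt hε)
        exact (((by fun_prop : Continuous fun u : ℝ =>
          Complex.exp (2 * Real.pi * T * u * Complex.I)).mul hφ).mul this).aestronglyMeasurable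
      · filter_upwards [Ioo_mem_nhdsGT one_pos] with ε hε
        refine ae_of_all _ fun u => ?_
        rw [norm_mul, norm_mul, hnorm, one_mul]
        by_cases hu : u ∈ tsupport φ
        · gcongr
          exact hB (ε, u) ⟨⟨hε.1.le, hε.2.le⟩, hu⟩
        · simp [image_eq_zero_of_notMem_tsupport hu]
      · refine ae_of_all _ fun u => Tendsto.const_mul _ ?_
        have hcont : ContinuousOn (fun ε : ℝ => H (ε + 2 * Real.pi * u * Complex.I))
            (Set.Ici 0) := hHc.comp (by fun_prop) fun ε hε => by simpa using hε
        exact (hcont 0 Set.self_mem_Ici).mono_left (nhdsWithin_mono _ Set.Ioi_subset_Ici_self)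
    refine tendsto_nhds_unique hL (hR.congr' ?_)
    filter_upwards [self_mem_nhdsWithin] with ε hε
    rw [integral_fourier_translate_mul hφint (hdamp ε hε)]
    simp_rw [hdampF ε hε]
  simp_rw [key]
  -- Riemann–Lebesgue for `u ↦ φ(u) H(2πiu)`, at frequency `-T`.
  have hRL := (Real.zero_at_infty_fourier
    (fun u : ℝ => φ u * H (((0 : ℝ) : ℂ) + 2 * Real.pi * u * Complex.I))).comp
    (tendsto_neg_atTop_atBot.mono_right atBot_le_cocompact)
  refine hRL.congr fun T => ?_
  rw [Function.comp_apply, fourier_eq_integral_exp]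
  congr 1 with u
  rw [← mul_assoc]
  congr 3
  push_cast
  ring

lemma fourier_comp_mul_left (φ : ℝ → ℂ) {δ : ℝ} (hδ : 0 < δ) (v : ℝ) :
    𝓕 (fun u => φ (δ * u)) v = (δ⁻¹ : ℝ) • 𝓕 φ (v / δ) := by
  rw [fourier_eq_integral_exp, fourier_eq_integral_exp, ← abs_of_pos (inv_pos.mpr hδ),
    ← Measure.integral_comp_mul_left]
  congr 1 with u
  congr 2
  have : (δ : ℂ) ≠ 0 := by exact_mod_cast hδ.ne'
  push_cast
  field_simp

/-- A Tauberian theorem: a bounded slowly oscillating function whose Laplace transform extends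
continuously to the closed right half plane tends to zero. -/
theorem tendsto_zero_of_laplace_continuousOn {F : ℝ → ℂ} (hFm : Measurable F) {C : ℝ}
    (hFC : ∀ t, ‖F t‖ ≤ C) (hF0 : ∀ t < 0, F t = 0)
    (hslow : ∀ s t : ℝ, 0 ≤ s → s ≤ t → ‖F t - F s‖ ≤ (t - s) + Real.exp (-s)) {H : ℂ → ℂ}
    (hHc : ContinuousOn H {s | 0 ≤ s.re})
    (hH : ∀ s : ℂ, 0 < s.re → ∫ t : ℝ, Complex.exp (-s * t) * F t = H s) :
    Tendsto F atTop (𝓝 0) := by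
  -- A smooth bump with value 1 at 0: its Fourier transform `K` has total mass 1 by inversion, and a
  -- finite first moment, against which the oscillation of `F` is integrated.
  obtain ⟨ψ, -, hψc, hψd, -, hψ0⟩ :=
    exists_contDiff_tsupport_subset (n := ⊤) (Filter.univ_mem : Set.univ ∈ 𝓝 (0 : ℝ))
  let φ : SchwartzMap ℝ ℂ := HasCompactSupport.toSchwartzMap (f := fun x => (ψ x : ℂ))
    (hψc.comp_left Complex.ofReal_zero) (Complex.ofRealCLM.contDiff.comp hψd)
  have hφc : HasCompactSupport φ := hψc.comp_left Complex.ofReal_zero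
  have hφ0 : φ 0 = 1 := by
    change ((ψ 0 : ℝ) : ℂ) = 1
    rw [hψ0, Complex.ofReal_one]
  have hKi : Integrable (𝓕 (φ : ℝ → ℂ)) := by
    rw [← SchwartzMap.fourier_coe]
    exact SchwartzMap.integrable _
  have hK1 : Integrable fun v : ℝ => |v| * ‖𝓕 (φ : ℝ → ℂ) v‖ := by
    rw [← SchwartzMap.fourier_coe]
    simpa using SchwartzMap.integrable_pow_mul volume (𝓕 φ) 1
  have hKone : ∫ v, 𝓕 (φ : ℝ → ℂ) v = 1 := by
    have := φ.integrable.fourierInv_fourier_eq hKi φ.continuous.continuousAt (v := 0)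
    rw [Real.fourierInv_eq', hφ0] at this
    simpa using this
  set K : ℝ → ℂ := 𝓕 (φ : ℝ → ℂ) with hK
  have hsmooth (δ : ℝ) (hδ : 0 < δ) :
      Tendsto (fun T : ℝ => ∫ w, K w * F (T + δ * w)) atTop (𝓝 0) := by
    have hscale : 𝓕 (fun u => φ (δ * u)) = fun v => (δ⁻¹ : ℝ) • K (v / δ) :=
      funext fun v => fourier_comp_mul_left φ hδ v
    have := tendsto_integral_fourier_translate_mul hFm hFC hF0 hHc hH
      (φ := fun u => φ (δ * u)) (φ.continuous.comp (by fun_prop))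
      (hφc.comp_homeomorph (Homeomorph.mulLeft₀ δ hδ.ne'))
      (by rw [hscale]; exact (hKi.comp_div hδ.ne').smul δ⁻¹)
    refine this.congr fun T => ?_
    rw [hscale]
    have h1 := Measure.integral_comp_mul_left (fun v => K (v / δ) * F (T + v)) δ
    rw [abs_of_pos (inv_pos.mpr hδ)] at h1
    have h2 := integral_sub_right_eq_self (μ := volume) (fun v => K (v / δ) * F (T + v)) T
    simp only [smul_mul_assoc]
    rw [integral_smul]
    simp only [add_sub_cancel] at h2
    rw [h2, ← h1]
    congr 1 with w
    rw [mul_div_cancel_left₀ _ hδ.ne']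
  have hC : 0 ≤ C := (norm_nonneg _).trans (hFC 0)
  -- For `v ≥ -T/2` both arguments are at least `T/2`, so slow oscillation applies. For `v < -T/2`
  -- it may not, but the trivial bound `2C ≤ T/2 < |v|` suffices; hence `4C ≤ T`.
  have hosc (T : ℝ) (hT0 : 0 ≤ T) (hT : 4 * C ≤ T) (v : ℝ) :
      ‖F T - F (T + v)‖ ≤ |v| + Real.exp (-(T / 2)) := by
    rcases le_or_gt (-(T / 2)) v with hv | hv
    · rcases le_total 0 v with h0 | h0
      · rw [norm_sub_rev, abs_of_nonneg h0]
        refine (hslow T (T + v) hT0 (by linarith)).trans ?_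
        gcongr <;> linarith
      · rw [abs_of_nonpos h0]
        refine (hslow (T + v) T (by linarith) (by linarith)).trans ?_
        gcongr <;> linarith
    · have h1 := norm_sub_le (F T) (F (T + v))
      have h2 := hFC T
      have h3 := hFC (T + v)
      have h4 := neg_abs_le v
      have h5 := Real.exp_nonneg (-(T / 2))
      linarith
  set M₀ := ∫ v, ‖K v‖
  set M₁ := ∫ v, |v| * ‖K v‖
  have hM₀ : 0 ≤ M₀ := integral_nonneg fun _ => norm_nonneg _
  have hM₁ : 0 ≤ M₁ := integral_nonneg fun _ => by positivity
  have hKF (δ T : ℝ) : Integrable fun w => K w * F (T + δ * w) :=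
    hKi.mul_bdd (c := C) (hFm.comp (by fun_prop)).aestronglyMeasurable (ae_of_all _ fun w => hFC _)
  have hbound (δ : ℝ) (hδ : 0 < δ) (T : ℝ) (hT0 : 0 ≤ T) (hT : 4 * C ≤ T) :
      ‖F T‖ ≤ ‖∫ w, K w * F (T + δ * w)‖ + (δ * M₁ + Real.exp (-(T / 2)) * M₀) := by
    have hsub : F T = (∫ w, K w * F (T + δ * w)) + ∫ w, K w * (F T - F (T + δ * w)) := by
      simp_rw [mul_sub]
      rw [integral_sub (hKi.mul_const _) (hKF δ T), integral_mul_const, hKone]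
      ring
    have hle : ‖∫ w, K w * (F T - F (T + δ * w))‖ ≤ δ * M₁ + Real.exp (-(T / 2)) * M₀ := by
      rw [← integral_const_mul, ← integral_const_mul,
        ← integral_add (hK1.const_mul _) (hKi.norm.const_mul _)]
      refine norm_integral_le_of_norm_le ((hK1.const_mul _).add (hKi.norm.const_mul _))
        (ae_of_all _ fun w => ?_)
      rw [norm_mul]
      refine (mul_le_mul_of_nonneg_left (hosc T hT0 hT (δ * w)) (norm_nonneg _)).trans_eq ?_
      rw [abs_mul, abs_of_pos hδ]
      ring
    calc ‖F T‖ = ‖(∫ w, K w * F (T + δ * w)) + ∫ w, K w * (F T - F (T + δ * w))‖ := by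
          rw [← hsub]
      _ ≤ _ := (norm_add_le _ _).trans (by gcongr)
  rw [tendsto_zero_iff_norm_tendsto_zero, Metric.tendsto_nhds]
  intro ε hε
  set δ := ε / (2 * (M₁ + 1)) with hδdef
  have hδ : 0 < δ := by positivity
  have hδM : δ * M₁ < ε := by
    have : δ * (2 * (M₁ + 1)) = ε := by rw [hδdef]; field_simp
    nlinarith
  have hlim : Tendsto (fun T : ℝ => ‖∫ w, K w * F (T + δ * w)‖ +
      (δ * M₁ + Real.exp (-(T / 2)) * M₀)) atTop (𝓝 (0 + (δ * M₁ + 0 * M₀))) := by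
    refine (tendsto_zero_iff_norm_tendsto_zero.mp (hsmooth δ hδ)).add
      (tendsto_const_nhds.add (Tendsto.mul_const _ ?_))
    exact Real.tendsto_exp_atBot.comp
      (tendsto_neg_atTop_atBot.comp (tendsto_id.atTop_div_const two_pos))
  filter_upwards [hlim.eventually_lt_const (by simpa using hδM), eventually_ge_atTop 0,
    eventually_ge_atTop (4 * C)] with T h1 h2 h3
  rw [dist_zero_right, norm_norm]
  exact (hbound δ hδ T h2 h3).trans_lt h1

end RamanujanExpansion

/-! ### The series of `μ(n)/n` -/

namespace RamanujanExpansion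

open MeasureTheory ArithmeticFunction
open scoped ArithmeticFunction.Moebius ArithmeticFunction.zeta

/-- The arithmetic function `n ↦ μ(n) / n`. -/
def moebiusDiv : ArithmeticFunction ℂ := ⟨fun n => (μ n : ℂ) / n, by simp⟩

@[simp] lemma moebiusDiv_apply (n : ℕ) : moebiusDiv n = (μ n : ℂ) / n := rfl

lemma norm_moebiusDiv_le (n : ℕ) : ‖moebiusDiv n‖ ≤ (n : ℝ)⁻¹ := by
  rw [moebiusDiv_apply, norm_div, Complex.norm_natCast, ← one_div, Complex.norm_intCast]
  gcongr
  exact_mod_cast abs_moebius_le_one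

/-- In `∑ μ(n) ⌊N/n⌋ = 1`, removing the floors costs at most 1 per term, so `N` times the sum has
norm at most `1 + N`. -/
lemma norm_sum_moebiusDiv_le (N : ℕ) : ‖∑ n ∈ Finset.Icc 1 N, moebiusDiv n‖ ≤ 2 := by
  rcases N.eq_zero_or_pos with rfl | hN
  · simp
  have hN' : (0 : ℝ) < N := by exact_mod_cast hN
  have hid : ∑ n ∈ Finset.Icc 1 N, (μ n : ℂ) * ((N / n : ℕ) : ℂ) = 1 := by
    have h := sum_Ioc_mul_zeta_eq_sum (R := ℤ) μ N
    rw [show (ζ : ArithmeticFunction ℤ) = ((ζ : ArithmeticFunction ℕ) : ArithmeticFunction ℤ)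
      from rfl, moebius_mul_coe_zeta] at h
    have h1 : ∑ n ∈ Finset.Ioc 0 N, (1 : ArithmeticFunction ℤ) n = 1 := by
      rw [Finset.sum_eq_single 1]
      · simp
      · intro b _ hb
        exact one_apply_ne hb
      · simp; omega
    rw [h1] at h
    have h2 : Finset.Icc 1 N = Finset.Ioc 0 N := rfl
    rw [h2]
    have h3 := congrArg (Int.cast : ℤ → ℂ) h.symm
    simpa only [Int.cast_sum, Int.cast_mul, Int.cast_natCast, Int.cast_one] using h3
  have hdiff : (N : ℂ) * ∑ n ∈ Finset.Icc 1 N, moebiusDiv n =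
      1 + ∑ n ∈ Finset.Icc 1 N, (μ n : ℂ) * ((N : ℂ) / n - ((N / n : ℕ) : ℂ)) := by
    rw [← hid, ← Finset.sum_add_distrib, Finset.mul_sum]
    refine Finset.sum_congr rfl fun n _ => ?_
    rw [moebiusDiv_apply]
    ring
  have hfrac : ‖∑ n ∈ Finset.Icc 1 N, (μ n : ℂ) * ((N : ℂ) / n - ((N / n : ℕ) : ℂ))‖ ≤ N := by
    refine (norm_sum_le_of_le (n := fun _ => 1) _ fun n hn => ?_).trans_eq (by simp)
    have hn : 0 < n := (Finset.mem_Icc.mp hn).1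
    rw [norm_mul, Complex.norm_intCast]
    have hf : ‖(N : ℂ) / n - ((N / n : ℕ) : ℂ)‖ ≤ 1 := by
      have e : (N : ℂ) / n - ((N / n : ℕ) : ℂ) = (((N : ℝ) / n - ((N / n : ℕ) : ℝ) : ℝ) : ℂ) := by
        push_cast; rfl
      rw [e, Complex.norm_real, Real.norm_eq_abs, abs_le]
      have h1 : ((N / n : ℕ) : ℝ) ≤ (N : ℝ) / n := Nat.cast_div_le
      have h2 : (N : ℝ) / n < ((N / n : ℕ) : ℝ) + 1 := by
        rw [← Nat.floor_div_eq_div (K := ℝ)]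
        exact Nat.lt_floor_add_one _
      constructor <;> linarith
    have hm : |((μ n : ℤ) : ℝ)| ≤ 1 := by exact_mod_cast abs_moebius_le_one
    nlinarith [norm_nonneg ((N : ℂ) / n - ((N / n : ℕ) : ℂ)), abs_nonneg ((μ n : ℤ) : ℝ)]
  have h1 : (N : ℝ) * ‖∑ n ∈ Finset.Icc 1 N, moebiusDiv n‖ ≤ 1 + N := by
    rw [← Complex.norm_natCast, ← norm_mul, hdiff]
    refine (norm_add_le _ _).trans ?_
    rw [norm_one, Complex.norm_natCast]
    gcongr
  have h2 : (1 : ℝ) ≤ N := by exact_mod_cast hN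
  by_contra! h
  nlinarith

/-- The sum of `μ(n) / n` over `n ≤ e ^ t`. -/
def moebiusDivSumExp (t : ℝ) : ℂ := ∑ n ∈ Finset.Icc 1 ⌊Real.exp t⌋₊, moebiusDiv n

lemma sum_Ioc_inv_le_log {k M : ℕ} (hk : 1 ≤ k) (hM : k ≤ M) :
    ∑ n ∈ Finset.Ioc k M, (n : ℝ)⁻¹ ≤ Real.log M - Real.log k := by
  induction M, hM using Nat.le_induction with
  | base => simp
  | succ M hM ih =>
    rw [Finset.sum_Ioc_succ_top (by omega)]
    have hM0 : (0 : ℝ) < M := by exact_mod_cast (by omega : 0 < M)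
    have h := Real.one_sub_inv_le_log_of_pos (x := ((M + 1 : ℕ) : ℝ) / M) (by positivity)
    rw [Real.log_div (by positivity) hM0.ne'] at h
    have e : 1 - (((M + 1 : ℕ) : ℝ) / M)⁻¹ = ((M + 1 : ℕ) : ℝ)⁻¹ := by
      push_cast
      field_simp
      ring
    rw [e] at h
    linarith

lemma norm_moebiusDivSumExp_sub_le {s t : ℝ} (hst : s ≤ t) :
    ‖moebiusDivSumExp t - moebiusDivSumExp s‖ ≤ (t - s) + Real.exp (-s) := by
  have hmM : ⌊Real.exp s⌋₊ ≤ ⌊Real.exp t⌋₊ := Nat.floor_le_floor (Real.exp_le_exp.mpr hst)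
  set m := ⌊Real.exp s⌋₊ with hm
  set M := ⌊Real.exp t⌋₊ with hMdef
  have hsub : moebiusDivSumExp t - moebiusDivSumExp s = ∑ n ∈ Finset.Ioc m M, moebiusDiv n := by
    have h := Finset.sum_Ioc_consecutive (fun n => moebiusDiv n) (Nat.zero_le m) hmM
    rw [sub_eq_iff_eq_add']
    exact h.symm
  rw [hsub]
  refine (norm_sum_le_of_le _ fun n _ => norm_moebiusDiv_le n).trans ?_
  rcases hmM.eq_or_lt with h | h
  · rw [h, Finset.Ioc_self, Finset.sum_empty]
    linarith [Real.exp_nonneg (-s)]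
  · have hm1 : Real.exp s < ((m + 1 : ℕ) : ℝ) := by
      push_cast
      exact Nat.lt_floor_add_one _
    have hM1 : (M : ℝ) ≤ Real.exp t := Nat.floor_le (Real.exp_nonneg t)
    have hM0 : (0 : ℝ) < M := by exact_mod_cast (by omega : 0 < M)
    -- The term `m + 1` is split off because `m ≤ e^s` gives no lower bound for `log m`, while `log
    -- (m + 1) ≥ s`; this term is the source of the extra `e^{-s}`.
    have h1 := Finset.sum_Ioc_consecutive (fun n : ℕ => (n : ℝ)⁻¹) (Nat.le_succ m) h
    rw [← h1, Nat.succ_eq_add_one, Finset.sum_Ioc_succ_top le_rfl, Finset.Ioc_self,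
      Finset.sum_empty, zero_add]
    have h2 := sum_Ioc_inv_le_log (Nat.succ_le_succ (Nat.zero_le m)) h
    have h3 : Real.log M ≤ t := by
      rw [Real.log_le_iff_le_exp hM0]
      exact hM1
    have h4 : s ≤ Real.log ((m + 1 : ℕ) : ℝ) := by
      rw [Real.le_log_iff_exp_le (by positivity)]
      exact hm1.le
    have h5 : ((m + 1 : ℕ) : ℝ)⁻¹ ≤ Real.exp (-s) := by
      rw [Real.exp_neg]
      gcongr
    rw [Nat.succ_eq_add_one] at h2
    linarith

/-- The continuous extension to the closed right half plane of the Laplace transform of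
`moebiusDivSumExp`. -/
def moebiusLaplace (s : ℂ) : ℂ := (Function.update (fun s => s * riemannZeta (1 + s)) 0 1 s)⁻¹

/-- The residue 1 of `ζ` gives the value at `s = 0`; the nonvanishing of `ζ` on `Re ≥ 1` permits
inversion. -/
lemma continuousOn_moebiusLaplace : ContinuousOn moebiusLaplace {s | 0 ≤ s.re} := by
  have hcont : Continuous (Function.update (fun s => s * riemannZeta (1 + s)) 0 1) := by
    refine continuous_iff_continuousAt.mpr fun s => ?_
    rcases eq_or_ne s 0 with rfl | hs
    · rw [continuousAt_update_same]
      have hmap : Tendsto (fun s : ℂ => 1 + s) (𝓝[≠] 0) (𝓝[≠] 1) := by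
        refine tendsto_nhdsWithin_iff.mpr ⟨?_, ?_⟩
        · have : Continuous fun s : ℂ => 1 + s := by fun_prop
          simpa using (this.tendsto 0).mono_left nhdsWithin_le_nhds
        · filter_upwards [self_mem_nhdsWithin] with s hs
          simpa using hs
      simpa [Function.comp_def] using riemannZeta_residue_one.comp hmap
    · rw [continuousAt_update_of_ne hs]
      refine continuousAt_id.mul (ContinuousAt.comp (g := riemannZeta)
        (differentiableAt_riemannZeta ?_).continuousAt (by fun_prop))
      simpa using hs
  refine hcont.continuousOn.inv₀ fun s hs => ?_
  rcases eq_or_ne s 0 with rfl | h0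
  · simp
  · rw [Function.update_of_ne h0]
    exact mul_ne_zero h0 (riemannZeta_ne_zero_of_one_le_re (by simpa using hs))

lemma LSeries_term_moebiusDiv (s : ℂ) (n : ℕ) :
    LSeries.term (moebiusDiv ·) s n = LSeries.term (fun n => (μ n : ℂ)) (1 + s) n := by
  rcases eq_or_ne n 0 with rfl | hn
  · simp
  · have : (n : ℂ) ≠ 0 := by exact_mod_cast hn
    rw [LSeries.term_of_ne_zero hn, LSeries.term_of_ne_zero hn, moebiusDiv_apply,
      Complex.cpow_add _ _ this, Complex.cpow_one, div_div]

/-- Partial summation for the L-series `1/ζ(1+s)`, with the substitution `x = e^t`. -/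
lemma integral_exp_mul_moebiusDivSumExp {s : ℂ} (hs : 0 < s.re) :
    ∫ t : ℝ, Complex.exp (-s * t) * moebiusDivSumExp t = moebiusLaplace s := by
  have hs0 : s ≠ 0 := by
    rintro rfl
    simp at hs
  have hs1 : 1 < (1 + s).re := by simpa using hs
  have hterm : LSeries.term (moebiusDiv ·) s = LSeries.term (fun n => (μ n : ℂ)) (1 + s) :=
    funext (LSeries_term_moebiusDiv s)
  have hL : LSeries (moebiusDiv ·) s = (riemannZeta (1 + s))⁻¹ := by
    have h := LSeries_one_mul_Lseries_moebius hs1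
    rw [LSeries_one_eq_riemannZeta hs1] at h
    rw [LSeries, hterm]
    exact eq_inv_of_mul_eq_one_right h
  have hsum : LSeriesSummable (moebiusDiv ·) s := by
    rw [LSeriesSummable, hterm]
    exact LSeriesSummable_moebius_iff.mpr hs1
  have hint := LSeries_eq_mul_integral (moebiusDiv ·) le_rfl hs hsum (by
    simp only [Real.rpow_zero]
    exact IsBigO.of_bound 2 (Eventually.of_forall fun n => by
      simpa using norm_sum_moebiusDiv_le n))
  have himage : Real.exp '' Set.Ioi 0 = Set.Ioi 1 := by
    ext x
    constructor
    · rintro ⟨y, hy, rfl⟩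
      exact Real.one_lt_exp_iff.mpr hy
    · intro hx
      exact ⟨Real.log x, Real.log_pos hx, Real.exp_log (zero_lt_one.trans hx)⟩
  have hcv : ∫ x in Set.Ioi (1 : ℝ), (∑ k ∈ Finset.Icc 1 ⌊x⌋₊, moebiusDiv k) * (x : ℂ) ^ (-(s + 1)) =
      ∫ t in Set.Ioi (0 : ℝ), Complex.exp (-s * t) * moebiusDivSumExp t := by
    rw [← himage, integral_image_eq_integral_abs_deriv_smul measurableSet_Ioi
      (fun x _ => (Real.hasDerivAt_exp x).hasDerivWithinAt) Real.exp_injective.injOn]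
    refine setIntegral_congr_fun measurableSet_Ioi fun t _ => ?_
    have hpow : ((Real.exp t : ℝ) : ℂ) ^ (-(s + 1)) = Complex.exp (-(s + 1) * t) := by
      rw [Complex.cpow_def_of_ne_zero (by exact_mod_cast (Real.exp_pos t).ne'),
        ← Complex.ofReal_log (Real.exp_nonneg t), Real.log_exp, mul_comm]
    have hmul : ((Real.exp t : ℝ) : ℂ) * Complex.exp (-(s + 1) * t) = Complex.exp (-s * t) := by
      rw [Complex.ofReal_exp, ← Complex.exp_add]
      congr 1
      ring
    simp only [hpow, abs_of_pos (Real.exp_pos t), Complex.real_smul]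
    rw [← hmul, moebiusDivSumExp]
    ring
  have hzero : ∫ t : ℝ, Complex.exp (-s * t) * moebiusDivSumExp t =
      ∫ t in Set.Ici (0 : ℝ), Complex.exp (-s * t) * moebiusDivSumExp t := by
    refine (setIntegral_eq_integral_of_forall_compl_eq_zero fun t ht => ?_).symm
    have : ⌊Real.exp t⌋₊ = 0 := by
      rw [Nat.floor_eq_zero]
      exact Real.exp_lt_one_iff.mpr (by simpa using ht)
    simp [moebiusDivSumExp, this]
  rw [hzero, integral_Ici_eq_integral_Ioi, ← hcv, moebiusLaplace, Function.update_of_ne hs0, mul_inv,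
    ← hL, hint, inv_mul_cancel_left₀ hs0]

/-- A form of the prime number theorem: the series of `μ(n) / n` converges to zero. -/
theorem tendsto_sum_moebiusDiv :
    Tendsto (fun N : ℕ => ∑ n ∈ Finset.Icc 1 N, moebiusDiv n) atTop (𝓝 0) := by
  have hmeas : Measurable moebiusDivSumExp :=
    (measurable_from_nat (f := fun N => ∑ n ∈ Finset.Icc 1 N, moebiusDiv n)).comp
      (Nat.measurable_floor.comp Real.measurable_exp)
  have h := tendsto_zero_of_laplace_continuousOn hmeas (fun t => norm_sum_moebiusDiv_le _)
    (fun t ht => by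
      have : ⌊Real.exp t⌋₊ = 0 := by
        rw [Nat.floor_eq_zero]
        exact Real.exp_lt_one_iff.mpr ht
      simp [moebiusDivSumExp, this])
    (fun s t _ => norm_moebiusDivSumExp_sub_le) continuousOn_moebiusLaplace
    (fun s => integral_exp_mul_moebiusDivSumExp)
  have hlog : Tendsto (fun N : ℕ => Real.log N) atTop atTop :=
    Real.tendsto_log_atTop.comp tendsto_natCast_atTop_atTop
  refine (h.comp hlog).congr' ?_
  filter_upwards [eventually_gt_atTop 0] with N hN
  simp only [Function.comp_apply, moebiusDivSumExp]
  rw [Real.exp_log (by exact_mod_cast hN), Nat.floor_natCast]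

end RamanujanExpansion

/-! ### Multiplicative perturbations of `μ(n)/n` -/

namespace RamanujanExpansion

open ArithmeticFunction
open scoped ArithmeticFunction.Moebius ArithmeticFunction.zeta

/-- A multiplicative function is absolutely summable as soon as the sum of its norms over the proper
prime powers is finite. -/
lemma summable_norm_of_summable_prime_pow {f : ArithmeticFunction ℂ} (hf : f.IsMultiplicative)
    (hpow : ∀ p : ℕ, p.Prime → Summable fun k : ℕ => ‖f (p ^ k)‖)
    (hsum : Summable ({p : ℕ | p.Prime}.indicator fun p => ∑' k : ℕ, ‖f (p ^ (k + 1))‖)) :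
    Summable fun n => ‖f n‖ := by
  set t : ℕ → ℝ := {p : ℕ | p.Prime}.indicator fun p => ∑' k : ℕ, ‖f (p ^ (k + 1))‖ with ht
  have ht0 (p : ℕ) : 0 ≤ t p :=
    Set.indicator_nonneg (fun p _ => tsum_nonneg fun k => norm_nonneg _) p
  refine summable_of_sum_range_le (c := Real.exp (∑' p, t p)) (fun n => norm_nonneg _) fun N => ?_
  -- Every `0 < n < N` is `N`-smooth, so the Euler product over primes below `N` bounds the partial
  -- sum; `1 + t ≤ e^t` makes the bound uniform in `N`.
  have hE := (EulerProduct.summable_and_hasSum_smoothNumbers_prod_primesBelow_tsum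
    (f := fun n => ‖f n‖) (by simp [hf.map_one])
    (fun {m n} hmn => by simp [hf.map_mul_of_coprime hmn])
    (fun {p} hp => by simpa using hpow p hp) N).2
  have hE' : HasSum (N.smoothNumbers.indicator fun n => ‖f n‖)
      (∏ p ∈ N.primesBelow, ∑' k, ‖f (p ^ k)‖) := hasSum_subtype_iff_indicator.mp hE
  calc ∑ n ∈ Finset.range N, ‖f n‖
      = ∑ n ∈ Finset.range N, N.smoothNumbers.indicator (fun n => ‖f n‖) n := by
        refine Finset.sum_congr rfl fun n hn => ?_
        rcases eq_or_ne n 0 with rfl | h0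
        · simp [Set.indicator_apply]
        · rw [Set.indicator_of_mem (Nat.mem_smoothNumbers_of_lt (Nat.pos_of_ne_zero h0)
            (Finset.mem_range.mp hn))]
    _ ≤ ∏ p ∈ N.primesBelow, ∑' k, ‖f (p ^ k)‖ :=
        sum_le_hasSum _ (fun n _ => Set.indicator_nonneg (fun n _ => norm_nonneg _) n) hE'
    _ ≤ ∏ p ∈ N.primesBelow, Real.exp (t p) := by
        refine Finset.prod_le_prod (fun p _ => tsum_nonneg fun k => norm_nonneg _) fun p hp => ?_
        have hp' := Nat.prime_of_mem_primesBelow hp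
        rw [(hpow p hp').tsum_eq_zero_add, ht, Set.indicator_of_mem (by exact hp'), pow_zero,
          hf.map_one, norm_one, add_comm]
        exact Real.add_one_le_exp _
    _ = Real.exp (∑ p ∈ N.primesBelow, t p) := (Real.exp_sum _ _).symm
    _ ≤ Real.exp (∑' p, t p) :=
        Real.exp_le_exp.mpr (hsum.sum_le_tsum _ fun p _ => ht0 p)

/-- The arithmetic function `n ↦ 1 / n`. -/
def invId : ArithmeticFunction ℂ := ⟨fun n => (n : ℂ)⁻¹, by simp⟩

@[simp] lemma invId_apply (n : ℕ) : invId n = (n : ℂ)⁻¹ := rfl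

lemma isMultiplicative_invId : invId.IsMultiplicative :=
  ⟨by simp, fun {m n} _ => by simp [mul_comm]⟩

lemma moebiusDiv_mul_invId : moebiusDiv * invId = 1 := by
  ext n
  rcases eq_or_ne n 0 with rfl | hn
  · simp
  have h1 : (moebiusDiv * invId) n = ((μ * (ζ : ArithmeticFunction ℤ)) n : ℤ) * (n : ℂ)⁻¹ := by
    rw [coe_mul_zeta_apply, ArithmeticFunction.mul_apply,
      Nat.sum_divisorsAntidiagonal (fun x y => moebiusDiv x * invId y), Int.cast_sum,
      Finset.sum_mul]
    refine Finset.sum_congr rfl fun d hd => ?_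
    have hdn := Nat.dvd_of_mem_divisors hd
    have hd0 : (d : ℂ) ≠ 0 := by exact_mod_cast (Nat.pos_of_mem_divisors hd).ne'
    have hn0 : (n : ℂ) ≠ 0 := by exact_mod_cast hn
    rw [moebiusDiv_apply, invId_apply, Nat.cast_div hdn hd0]
    field_simp
  rw [h1, moebius_mul_coe_zeta]
  rcases eq_or_ne n 1 with rfl | h
  · simp
  · simp [one_apply_ne h]

/-- Only the divisors `1` and `p` contribute. The defect `g p + 1/p` factors out at every power,
which makes `g * invId` absolutely summable. -/
lemma mul_invId_prime_pow_succ {g : ArithmeticFunction ℂ} (hg : g.IsMultiplicative)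
    (hsq : ∀ p k : ℕ, p.Prime → 2 ≤ k → g (p ^ k) = 0) {p : ℕ} (hp : p.Prime) (k : ℕ) :
    (g * invId) (p ^ (k + 1)) = ((p : ℂ)⁻¹) ^ k * (g p + 1 / p) := by
  have hp0 : (p : ℂ) ≠ 0 := by exact_mod_cast hp.ne_zero
  rw [ArithmeticFunction.mul_apply, Nat.sum_divisorsAntidiagonal (fun x y => g x * invId y),
    Nat.sum_divisors_prime_pow hp, Finset.sum_range_succ', Finset.sum_range_succ',
    Finset.sum_eq_zero fun i _ => ?_]
  · rw [zero_add, pow_one, pow_zero, hg.map_one, Nat.div_one, pow_succ,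
      Nat.mul_div_cancel _ hp.pos]
    simp only [invId_apply, Nat.cast_mul, Nat.cast_pow]
    rw [one_div, inv_pow]
    field_simp
  · rw [hsq p _ hp (by omega), zero_mul]

/-- If a multiplicative function vanishes at the higher prime powers and is close to `-1 / p` at the
primes, then its series converges to zero. -/
theorem tendsto_sum_zero_of_summable_prime {g : ArithmeticFunction ℂ} (hg : g.IsMultiplicative)
    (hsq : ∀ p k : ℕ, p.Prime → 2 ≤ k → g (p ^ k) = 0)
    (hsum : Summable ({p : ℕ | p.Prime}.indicator fun p => ‖g p + 1 / (p : ℂ)‖)) :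
    Tendsto (fun N : ℕ => ∑ n ∈ Finset.Icc 1 N, g n) atTop (𝓝 0) := by
  set h := g * invId with hh
  have hgeom {p : ℕ} (hp : p.Prime) :
      HasSum (fun k : ℕ => ‖h (p ^ (k + 1))‖) ((1 - (p : ℝ)⁻¹)⁻¹ * ‖g p + 1 / (p : ℂ)‖) := by
    have hlt : (p : ℝ)⁻¹ < 1 := inv_lt_one_of_one_lt₀ (by exact_mod_cast hp.one_lt)
    refine ((hasSum_geometric_of_lt_one (by positivity) hlt).mul_right _).congr_fun ?_
    intro k
    rw [hh, mul_invId_prime_pow_succ hg hsq hp, norm_mul, norm_pow, norm_inv,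
      Complex.norm_natCast]
  have hhsum : Summable fun n => ‖h n‖ := by
    refine summable_norm_of_summable_prime_pow (hg.mul isMultiplicative_invId)
      (fun p hp => (summable_nat_add_iff 1).mp (hgeom hp).summable) ?_
    -- The 2 bounds `(1 - 1/p)⁻¹` for `p ≥ 2`.
    refine (hsum.mul_left 2).of_nonneg_of_le
      (fun p => Set.indicator_nonneg (fun p _ => tsum_nonneg fun k => norm_nonneg _) p) fun p => ?_
    by_cases hp : p.Prime
    · rw [Set.indicator_of_mem (by exact hp), Set.indicator_of_mem (by exact hp),
        (hgeom hp).tsum_eq]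
      gcongr
      have h2 : (p : ℝ)⁻¹ ≤ 2⁻¹ := by
        gcongr
        exact_mod_cast hp.two_le
      exact inv_le_of_inv_le₀ two_pos (by linarith)
    · rw [Set.indicator_of_notMem (by exact hp), Set.indicator_of_notMem (by exact hp), mul_zero]
  have hgh : g = h * moebiusDiv := by
    rw [hh, mul_assoc, mul_comm invId, moebiusDiv_mul_invId, mul_one]
  set U : ℕ → ℂ := fun N => ∑ n ∈ Finset.Icc 1 N, moebiusDiv n with hU
  -- For `n > N` the sum `U (N / n)` is empty, so the range may be extended to all `n`, ready for
  -- dominated convergence with bound `2‖h n‖`.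
  have hexp (N : ℕ) : ∑ n ∈ Finset.Icc 1 N, g n = ∑' n, h n * U (N / n) := by
    have e : ∑ n ∈ Finset.Icc 1 N, g n = ∑ n ∈ Finset.Icc 1 N, h n * U (N / n) := by
      conv_lhs => rw [hgh]
      exact sum_Ioc_mul_eq_sum_sum h moebiusDiv N
    rw [e]
    refine (tsum_eq_sum fun n hn => ?_).symm
    rcases eq_or_ne n 0 with rfl | h0
    · simp
    · have : N < n := by
        by_contra! hle
        exact hn (Finset.mem_Icc.mpr ⟨Nat.pos_of_ne_zero h0, hle⟩)
      simp [hU, Nat.div_eq_of_lt this]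
  simp_rw [hexp]
  have hlim := tendsto_tsum_of_dominated_convergence (𝓕 := (atTop : Filter ℕ))
    (f := fun N n => h n * U (N / n)) (g := fun _ => 0) (hhsum.mul_right 2) (fun n => ?_)
    (Eventually.of_forall fun N n => ?_)
  · simpa using hlim
  · rcases eq_or_ne n 0 with rfl | h0
    · simp
    · rw [← mul_zero (h n)]
      exact (tendsto_sum_moebiusDiv.comp (Nat.tendsto_div_const_atTop h0)).const_mul (h n)
  · rw [norm_mul]
    gcongr
    exact norm_sum_moebiusDiv_le _

end RamanujanExpansion

/-! ### Ramanujan sums and reduction to coprime Möbius sums -/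

namespace RamanujanExpansion

open ArithmeticFunction
open scoped ArithmeticFunction.Moebius ArithmeticFunction.zeta

lemma sum_Icc_filter_dvd (f : ℕ → ℂ) {d : ℕ} (hd : 0 < d) (N : ℕ) :
    ∑ n ∈ (Finset.Icc 1 N).filter (d ∣ ·), f n = ∑ m ∈ Finset.Icc 1 (N / d), f (d * m) := by
  symm
  refine Finset.sum_nbij' (fun m => d * m) (fun n => n / d) ?_ ?_ ?_ ?_ ?_
  · intro m hm
    rw [Finset.mem_Icc, Nat.le_div_iff_mul_le hd] at hm
    rw [Finset.mem_filter, Finset.mem_Icc, mul_comm]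
    exact ⟨⟨Nat.mul_pos hm.1 hd, hm.2⟩, dvd_mul_left d m⟩
  · intro n hn
    rw [Finset.mem_filter, Finset.mem_Icc] at hn
    rw [Finset.mem_Icc]
    exact ⟨Nat.div_pos (Nat.le_of_dvd hn.1.1 hn.2) hd, Nat.div_le_div_right hn.1.2⟩
  · intro m _
    exact Nat.mul_div_cancel_left m hd
  · intro n hn
    exact Nat.mul_div_cancel' (Finset.mem_filter.mp hn).2
  · intro m _
    rfl

lemma sum_exp_eq_ite {m : ℕ} (hm : 0 < m) (a : ℕ) :
    ∑ j ∈ Finset.Icc 1 m, Complex.exp (2 * Real.pi * Complex.I * a * j / m) =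
      if m ∣ a then (m : ℂ) else 0 := by
  have hm0 : (m : ℂ) ≠ 0 := by exact_mod_cast hm.ne'
  set z := Complex.exp (2 * Real.pi * Complex.I * a / m) with hz
  have hpow (j : ℕ) : Complex.exp (2 * Real.pi * Complex.I * a * j / m) = z ^ j := by
    rw [hz, ← Complex.exp_nat_mul]
    congr 1
    ring
  have hzm : z ^ m = 1 := by
    rw [← hpow, Complex.exp_eq_one_iff]
    refine ⟨a, ?_⟩
    push_cast
    field_simp
  have hz1 : z = 1 ↔ m ∣ a := by
    rw [hz, Complex.exp_eq_one_iff]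
    constructor
    · rintro ⟨n, hn⟩
      have h : (a : ℂ) = m * n := by
        have h2 := Complex.two_pi_I_ne_zero
        rw [div_eq_iff hm0] at hn
        apply mul_left_cancel₀ h2
        rw [hn]
        ring
      have h' : (a : ℤ) = m * n := by exact_mod_cast h
      exact Int.natCast_dvd_natCast.mp ⟨n, h'⟩
    · rintro ⟨n, rfl⟩
      refine ⟨n, ?_⟩
      push_cast
      field_simp
  simp_rw [hpow]
  split_ifs with h
  · simp [hz1.mpr h]
  · have hne : z ≠ 1 := fun h' => h (hz1.mp h')
    rw [← Finset.Ico_add_one_right_eq_Icc, geom_sum_Ico hne (by omega), pow_succ, hzm, pow_one,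
      one_mul, sub_self, zero_div]

lemma sum_moebius_divisors_filter_dvd {q : ℕ} (hq : 0 < q) (h : ℕ) :
    ∑ k ∈ q.divisors.filter (· ∣ h), (μ k : ℂ) = if Nat.Coprime h q then 1 else 0 := by
  have e : q.divisors.filter (· ∣ h) = (h.gcd q).divisors := by
    ext k
    simp only [Finset.mem_filter, Nat.mem_divisors, Nat.dvd_gcd_iff]
    have := (Nat.gcd_pos_of_pos_right h hq).ne'
    have := hq.ne'
    tauto
  have hs : ∑ k ∈ (h.gcd q).divisors, μ k = (1 : ArithmeticFunction ℤ) (h.gcd q) := by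
    rw [← coe_mul_zeta_apply, moebius_mul_coe_zeta]
  rw [e, ← Int.cast_sum, hs, one_apply]
  by_cases hc : h.gcd q = 1
  · rw [if_pos hc, if_pos hc, Int.cast_one]
  · rw [if_neg hc, if_neg hc, Int.cast_zero]

/-- The formula of von Sterneck and Kluyver for the Ramanujan sum. -/
lemma ramanujanSum_eq_sum_divisors {q : ℕ} (hq : 0 < q) {a : ℕ} (ha : 0 < a) :
    ramanujanSum q a = ∑ d ∈ a.divisors.filter (· ∣ q), (d : ℂ) * μ (q / d) := by
  -- Möbius inversion detects coprimality; writing `h = kj` leaves full sums of roots of unity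
  -- modulo `q / k`. The later reindexing is `d = q / k`.
  have h1 : ramanujanSum q a = ∑ k ∈ q.divisors, (μ k : ℂ) *
      if q / k ∣ a then ((q / k : ℕ) : ℂ) else 0 := by
    calc ramanujanSum q a
        = ∑ h ∈ Finset.Icc 1 q, ∑ k ∈ q.divisors, if k ∣ h then
            (μ k : ℂ) * Complex.exp (2 * Real.pi * Complex.I * a * h / q) else 0 := by
          rw [ramanujanSum, Finset.sum_filter]
          refine Finset.sum_congr rfl fun h _ => ?_
          rw [← Finset.sum_filter, ← Finset.sum_mul, sum_moebius_divisors_filter_dvd hq]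
          split_ifs <;> simp
      _ = ∑ k ∈ q.divisors, (μ k : ℂ) * ∑ j ∈ Finset.Icc 1 (q / k),
            Complex.exp (2 * Real.pi * Complex.I * a * j / ((q / k : ℕ) : ℂ)) := by
          rw [Finset.sum_comm]
          refine Finset.sum_congr rfl fun k hk => ?_
          have hk0 := Nat.pos_of_mem_divisors hk
          have hk1 : (k : ℂ) ≠ 0 := by exact_mod_cast hk0.ne'
          have hq1 : (q : ℂ) ≠ 0 := by exact_mod_cast hq.ne'
          rw [← Finset.sum_filter, sum_Icc_filter_dvd _ hk0, Finset.mul_sum]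
          refine Finset.sum_congr rfl fun j _ => ?_
          rw [Nat.cast_div (Nat.dvd_of_mem_divisors hk) hk1]
          congr 2
          push_cast
          field_simp
      _ = _ := by
          refine Finset.sum_congr rfl fun k hk => ?_
          rw [sum_exp_eq_ite (Nat.div_pos (Nat.divisor_le hk) (Nat.pos_of_mem_divisors hk))]
  rw [h1, ← Nat.sum_div_divisors, Finset.sum_filter]
  have h2 : ∀ d ∈ q.divisors, (μ (q / d) : ℂ) *
      (if q / (q / d) ∣ a then ((q / (q / d) : ℕ) : ℂ) else 0) =
      if d ∣ a then (d : ℂ) * μ (q / d) else 0 := by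
    intro d hd
    rw [Nat.div_div_self (Nat.dvd_of_mem_divisors hd) hq.ne']
    split_ifs <;> ring
  rw [Finset.sum_congr rfl h2, ← Finset.sum_filter, ← Finset.sum_filter]
  refine Finset.sum_congr ?_ fun _ _ => rfl
  ext d
  simp only [Finset.mem_filter, Nat.mem_divisors]
  have := hq.ne'
  have := ha.ne'
  tauto

lemma partialSum_eq_sum_divisors (G : ArithmeticFunction ℂ) {a : ℕ} (ha : 0 < a) (Q : ℕ) :
    partialSum G a Q =
      ∑ d ∈ a.divisors, (d : ℂ) * ∑ m ∈ Finset.Icc 1 (Q / d), (μ m : ℂ) * G (d * m) := by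
  calc partialSum G a Q
      = ∑ q ∈ Finset.Icc 1 Q, ∑ d ∈ a.divisors,
          if d ∣ q then G q * ((d : ℂ) * μ (q / d)) else 0 := by
        refine Finset.sum_congr rfl fun q hq => ?_
        rw [ramanujanSum_eq_sum_divisors (Finset.mem_Icc.mp hq).1 ha, Finset.mul_sum,
          Finset.sum_filter]
    _ = _ := by
        rw [Finset.sum_comm]
        refine Finset.sum_congr rfl fun d hd => ?_
        have hd0 := Nat.pos_of_mem_divisors hd
        rw [← Finset.sum_filter, sum_Icc_filter_dvd _ hd0, Finset.mul_sum]
        refine Finset.sum_congr rfl fun m _ => ?_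
        rw [Nat.mul_div_cancel_left m hd0]
        ring

/-- The function `μ G`, restricted to the integers coprime to `d`. -/
def moebiusMulCoprime (G : ArithmeticFunction ℂ) (d : ℕ) : ArithmeticFunction ℂ :=
  ⟨fun n => if n.Coprime d then (μ n : ℂ) * G n else 0, by simp⟩

lemma moebiusMulCoprime_apply (G : ArithmeticFunction ℂ) (d n : ℕ) :
    moebiusMulCoprime G d n = if n.Coprime d then (μ n : ℂ) * G n else 0 := rfl

lemma isMultiplicative_moebiusMulCoprime {G : ArithmeticFunction ℂ} (hG : G.IsMultiplicative)
    (d : ℕ) : (moebiusMulCoprime G d).IsMultiplicative := by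
  refine ⟨by simp [moebiusMulCoprime_apply, hG.map_one], fun {m n} hmn => ?_⟩
  simp only [moebiusMulCoprime_apply, Nat.coprime_mul_iff_left, hG.map_mul_of_coprime hmn,
    isMultiplicative_moebius.map_mul_of_coprime hmn]
  by_cases hm : m.Coprime d
  · by_cases hn : n.Coprime d
    · rw [if_pos ⟨hm, hn⟩, if_pos hm, if_pos hn]
      push_cast
      ring
    · rw [if_neg fun h => hn h.2, if_neg hn, mul_zero]
  · rw [if_neg fun h => hm h.1, if_neg hm, zero_mul]

/-- If `j` is coprime to `d`, the gcd condition is automatic and both functions factor. Otherwise a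
prime dividing `j` and `d` also divides `e` when the gcd is `e`, so `ej` is not squarefree and `μ`
kills the term. -/
lemma ite_gcd_eq_moebius_mul {G : ArithmeticFunction ℂ} (hG : G.IsMultiplicative) {d e : ℕ}
    (he : e ∣ d) (j : ℕ) :
    (if (e * j).gcd d = e then (μ (e * j) : ℂ) * G (d * (e * j)) else 0) =
      μ e * G (d * e) * moebiusMulCoprime G d j := by
  rw [moebiusMulCoprime_apply]
  by_cases hj : j.Coprime d
  · have hje : j.Coprime e := hj.coprime_dvd_right he
    rw [if_pos hj, if_pos, isMultiplicative_moebius.map_mul_of_coprime hje.symm, ← mul_assoc d,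
      hG.map_mul_of_coprime (hj.mul_right hje).symm]
    · push_cast
      ring
    · rw [hj.gcd_mul_right_cancel, Nat.gcd_eq_left he]
  · rw [if_neg hj, mul_zero]
    split_ifs with h
    · have : ¬ Squarefree (e * j) := by
        intro hsq
        obtain ⟨p, hp, hpj, hpd⟩ := Nat.Prime.not_coprime_iff_dvd.mp hj
        have hpe : p ∣ e := h ▸ Nat.dvd_gcd (hpj.mul_left e) hpd
        exact Nat.not_coprime_of_dvd_of_dvd hp.one_lt hpe hpj (Nat.coprime_of_squarefree_mul hsq)
      rw [moebius_eq_zero_of_not_squarefree this]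
      simp
    · rfl

lemma sum_moebius_mul_apply_mul {G : ArithmeticFunction ℂ} (hG : G.IsMultiplicative) {d : ℕ}
    (hd : 0 < d) (N : ℕ) :
    ∑ m ∈ Finset.Icc 1 N, (μ m : ℂ) * G (d * m) =
      ∑ e ∈ d.divisors, μ e * G (d * e) *
        ∑ j ∈ Finset.Icc 1 (N / e), moebiusMulCoprime G d j := by
  rw [← Finset.sum_fiberwise_of_maps_to (s := Finset.Icc 1 N) (t := d.divisors)
    (g := fun m => m.gcd d) fun m _ => Nat.mem_divisors.mpr ⟨Nat.gcd_dvd_right m d, hd.ne'⟩]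
  refine Finset.sum_congr rfl fun e he => ?_
  have hfilter : (Finset.Icc 1 N).filter (fun m => m.gcd d = e) =
      ((Finset.Icc 1 N).filter (e ∣ ·)).filter fun m => m.gcd d = e := by
    ext m
    simp only [Finset.mem_filter]
    constructor
    · rintro ⟨h1, h2⟩
      exact ⟨⟨h1, h2 ▸ Nat.gcd_dvd_left m d⟩, h2⟩
    · rintro ⟨⟨h1, -⟩, h2⟩
      exact ⟨h1, h2⟩
  rw [hfilter, Finset.sum_filter, sum_Icc_filter_dvd _ (Nat.pos_of_mem_divisors he),
    Finset.mul_sum]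
  exact Finset.sum_congr rfl fun j _ => ite_gcd_eq_moebius_mul hG (Nat.dvd_of_mem_divisors he) j

lemma tendsto_sum_moebiusMulCoprime {G : ArithmeticFunction ℂ} (hG : G.IsMultiplicative)
    {α : ℝ} (hα : 0 < α)
    (hprime : (fun p : ℕ => G p - 1 / (p : ℂ)) =O[atTop ⊓ 𝓟 {p : ℕ | p.Prime}]
      (fun p : ℕ => (p : ℝ) ^ (-1 - α))) {d : ℕ} (hd : 0 < d) :
    Tendsto (fun N : ℕ => ∑ n ∈ Finset.Icc 1 N, moebiusMulCoprime G d n) atTop (𝓝 0) := by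
  refine tendsto_sum_zero_of_summable_prime (isMultiplicative_moebiusMulCoprime hG d)
    (fun p k hp hk => ?_) ?_
  · have hk1 : k ≠ 1 := by omega
    simp [moebiusMulCoprime_apply, moebius_apply_prime_pow hp (by omega : k ≠ 0), hk1]
  · rw [← summable_subtype_iff_indicator]
    have htend : Tendsto (fun p : {p : ℕ | p.Prime} => (p : ℕ)) cofinite
        (atTop ⊓ 𝓟 {p : ℕ | p.Prime}) := by
      rw [tendsto_inf, tendsto_principal, ← Nat.cofinite_eq_atTop]
      exact ⟨Subtype.coe_injective.tendsto_cofinite, Eventually.of_forall fun p => p.2⟩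
    have hsum : Summable fun p : {p : ℕ | p.Prime} => ((p : ℕ) : ℝ) ^ (-1 - α) :=
      Nat.Primes.summable_rpow.mpr (by linarith)
    refine summable_of_isBigO hsum (((hprime.comp_tendsto htend).norm_left).congr' ?_
      EventuallyEq.rfl)
    -- Coprimality to `d` excludes only finitely many primes, none larger than `d`.
    have hlarge := (tendsto_inf.mp htend).1.eventually (eventually_gt_atTop d)
    filter_upwards [hlarge] with p hp
    have hcop : (p : ℕ).Coprime d :=
      (Nat.Prime.coprime_iff_not_dvd p.2).mpr fun h => (Nat.le_of_dvd hd h).not_gt hp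
    simp only [Function.comp_apply]
    rw [moebiusMulCoprime_apply, if_pos hcop, moebius_apply_prime p.2, ← norm_neg]
    congr 1
    push_cast
    ring

/-- The Ramanujan series of a multiplicative function close to `1 / p` at the primes converges to
zero. -/
theorem tendsto_partialSum_zero {G : ArithmeticFunction ℂ} (hG : G.IsMultiplicative)
    {α : ℝ} (hα : 0 < α)
    (hprime : (fun p : ℕ => G p - 1 / (p : ℂ)) =O[atTop ⊓ 𝓟 {p : ℕ | p.Prime}]
      (fun p : ℕ => (p : ℝ) ^ (-1 - α))) {a : ℕ} (ha : 0 < a) :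
    Tendsto (partialSum G a) atTop (𝓝 0) := by
  have hinner (d : ℕ) (hd : 0 < d) :
      Tendsto (fun N : ℕ => ∑ m ∈ Finset.Icc 1 N, (μ m : ℂ) * G (d * m)) atTop (𝓝 0) := by
    simp_rw [sum_moebius_mul_apply_mul hG hd]
    rw [← Finset.sum_const_zero (s := d.divisors)]
    refine tendsto_finsetSum _ fun e he => ?_
    rw [← mul_zero ((μ e : ℂ) * G (d * e))]
    exact ((tendsto_sum_moebiusMulCoprime hG hα hprime hd).comp
      (Nat.tendsto_div_const_atTop (Nat.pos_of_mem_divisors he).ne')).const_mul _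
  rw [funext (partialSum_eq_sum_divisors G ha), ← Finset.sum_const_zero (s := a.divisors)]
  refine tendsto_finsetSum _ fun d hd => ?_
  have hd0 := Nat.pos_of_mem_divisors hd
  rw [← mul_zero (d : ℂ)]
  exact ((hinner d hd0).comp (Nat.tendsto_div_const_atTop hd0.ne')).const_mul _

end RamanujanExpansion

end

theorem proposition1 (G : ArithmeticFunction ℂ) (hmult : G.IsMultiplicative)
    (hexotic : ¬ RamanujanExpansion.IsExotic G)
    (hsqfree : (fun q : ℕ => G q) =O[atTop ⊓ 𝓟 {q : ℕ | Squarefree q}]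
      (fun q : ℕ => (1 / q : ℝ)))
    (α : ℝ) (hα : 0 < α)
    (hprime : (fun p : ℕ => G p - 1 / (p : ℂ)) =O[atTop ⊓ 𝓟 {p : ℕ | p.Prime}]
      (fun p : ℕ => (p : ℝ) ^ (-1 - α))) :
    RamanujanExpansion.IsRamanujanCoefficient G ∧
      G ∈ RamanujanExpansion.ramanujanCloud 0 :=
  have hzero (a : ℕ) (ha : 1 ≤ a) :
      Tendsto (RamanujanExpansion.partialSum G a) atTop (𝓝 0) :=
    RamanujanExpansion.tendsto_partialSum_zero hmult hα hprime ha
  ⟨fun a ha => ⟨0, hzero a ha⟩, fun a ha => hzero a ha⟩
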